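/- Let $\mathbb{Q}\langle d,j,y\rangle$ be the non-commutative polynomial $\mathbb{Q}$-algebra on three letters $d,j,y$ subject to $dj=jd=1$; write $j^{-k}=d^{k}$ for $k\ge 1$. It has as a basis the reduced words, i.e. the words containing neither $dj$ nor $jd$; these are the words $j^{k_1}yj^{k_2}y\cdots yj^{k_s}$ with $s\ge 1$ and $k_1,\dots,k_s\in\mathbb{Z}$. Define a $\mathbb{Q}$-bilinear product $\sqcup\!\sqcup_0$ on $\mathbb{Q}\langle d,j,y\rangle$ recursively on reduced words by $w\sqcup\!\sqcup_0 1=1\sqcup\!\sqcup_0 w=w$ and $$\begin{aligned} yu\sqcup\!\sqcup_0 v&=y(u\sqcup\!\sqcup_0 v),\qquad u\sqcup\!\sqcup_0 yv=y(u\sqcup\!\sqcup_0 v),\\ ju\sqcup\!\sqcup_0 jv&=j(u\sqcup\!\sqcup_0 jv)+j(ju\sqcup\!\sqcup_0 v),\\ du\sqcup\!\sqcup_0 dv&=d(u\sqcup\!\sqcup_0 dv)-u\sqcup\!\sqcup_0 d^2v,\\ du\sqcup\!\sqcup_0 jv&=d(u\sqcup\!\sqcup_0 jv)-u\sqcup\!\sqcup_0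 v,\\ ju\sqcup\!\sqcup_0 dv&=d(ju\sqcup\!\sqcup_0 v)-u\sqcup\!\sqcup_0 v, \end{aligned}$$ where the words displayed as arguments on the left-hand sides are reduced. Let $\mathcal{T}$ be the linear span of the words $j^{k_1}y\cdots yj^{k_s}$ with $s\ge1$, $k_i\in\mathbb{Z}$ and $k_s\neq 0$. Let $\mathcal{L}$ be the two-sided ideal of the (non-associative) algebra $(\mathbb{Q}\langle d,j,y\rangle,\sqcup\!\sqcup_0)$ generated by the elements $$j^k\bigl(d(u\sqcup\!\sqcup_0 v)-du\sqcup\!\sqcup_0 v-u\sqcup\!\sqcup_0 dv\bigr),$$ where $k\in\mathbb{Z}$ and $u,v$ are reduced words ending in $y$. Let $\mathbb{Q}\langle d,y\rangle\subset\mathbb{Q}\langle d,j,y\rangle$ be the subalgebra generated by $d$ and $y$, which is closed under $\sqcup\!\sqcup_0$, put $\mathcal{T}_-=\mathbb{Q}\langle d,y\rangle\cap\mathcal{T}$ and $\mathcal{L}_-=\mathbb{Q}\langle d,y\rangle\cap\mathcal{L}$, and let $$\mathcal{H}_-=\mathbb{Q}\langle d,y\rangle/(\mathcal{T}_-+\mathcal{L}_-)$$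 with the product induced by $\sqcup\!\sqcup_0$ (the subspace $\mathcal{T}_-+\mathcal{L}_-$ is a two-sided ideal of $(\mathbb{Q}\langle d,y\rangle,\sqcup\!\sqcup_0)$). Then for all integers $r\ge 2$ and $k_1,\dots,k_r\ge 0$ the following identity holds in $\mathcal{H}_-$: $$d^{k_1}y\,d^{k_2}y\cdots d^{k_r}y=\sum_{\substack{i+j=k_1\\ i,j\ge 0}}\binom{k_1}{i}\,\bigl(d^{i}y\bigr)\sqcup\!\sqcup_0\bigl(d^{j}d^{k_2}y\,d^{k_3}y\cdots d^{k_r}y\bigr)$$ (here the summation index $j$ is an integer, not the letter $j$). -/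

import Mathlib

noncomputable section

namespace ShuffleZero

/-! ### Words in `d, j, y` with `dj = jd = 1` -/

/-- A reduced word in the letters `d, j, y`, where `dj = jd = 1`.  With `d = j⁻¹`, every word is
uniquely of the form `j^{k₁} y j^{k₂} y ⋯ y j^{kᵣ}` with `r ≥ 1` and integers `k₁, …, kᵣ`; here
`exp = k₁` and `tail = [k₂, …, kᵣ]`. -/
@[ext] structure Word where
  exp : ℤ
  tail : List ℤ

namespace Word

/-- Concatenation (followed by reduction) of `j^k y j^{a₁} y ⋯` with `w`. -/
def mulAux : ℤ → List ℤ → Word → Word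
  | k, [], w => ⟨k + w.exp, w.tail⟩
  | k, a :: l, w => ⟨k, (mulAux a l w).exp :: (mulAux a l w).tail⟩

instance : Mul Word := ⟨fun u v => mulAux u.exp u.tail v⟩
instance : One Word := ⟨⟨0, []⟩⟩

theorem one_def : (1 : Word) = ⟨0, []⟩ := rfl
theorem mul_nil (k : ℤ) (w : Word) : (⟨k, []⟩ : Word) * w = ⟨k + w.exp, w.tail⟩ := rfl
theorem mul_cons (k a : ℤ) (l : List ℤ) (w : Word) :
    (⟨k, a :: l⟩ : Word) * w =
      ⟨k, ((⟨a, l⟩ : Word) * w).exp :: ((⟨a, l⟩ : Word) * w).tail⟩ := rfl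

theorem exp_mul_assoc (k : ℤ) (u v : Word) :
    (⟨k + u.exp, u.tail⟩ : Word) * v = ⟨k + (u * v).exp, (u * v).tail⟩ := by
  rcases u with ⟨a, _ | ⟨b, l⟩⟩
  · simp [mul_nil, add_assoc]
  · simp [mul_cons]

instance : Monoid Word where
  one_mul w := by simp [one_def, mul_nil]
  mul_one w := by
    rcases w with ⟨k, l⟩
    induction l generalizing k with
    | nil => simp [one_def, mul_nil]
    | cons a l ih => rw [mul_cons, ih]
  mul_assoc u v w := by
    rcases u with ⟨k, l⟩
    induction l generalizing k with
    | nil => rw [mul_nil, mul_nil, exp_mul_assoc]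
    | cons a l ih => rw [mul_cons, mul_cons, mul_cons, ← ih]

/-- The one-letter words `d`, `j` and `y`. -/
def d : Word := ⟨-1, []⟩
def j : Word := ⟨1, []⟩
def y : Word := ⟨0, [0]⟩

theorem d_mul (w : Word) : d * w = ⟨-1 + w.exp, w.tail⟩ := rfl
theorem j_mul (w : Word) : j * w = ⟨1 + w.exp, w.tail⟩ := rfl
theorem y_mul (w : Word) : y * w = ⟨0, w.exp :: w.tail⟩ := by
  simp [y, mul_cons, mul_nil]
theorem d_mul_j : d * j = 1 := rfl
theorem j_mul_d : j * d = 1 := rfl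

/-- The exponent `kᵣ` of `j^{k₁} y ⋯ y j^{kᵣ}`. -/
def lastExp (w : Word) : ℤ := (w.exp :: w.tail).getLast (List.cons_ne_nil _ _)

/-- The words ending in `y`, that is, the words `j^{k₁} y ⋯ j^{kₛ} y` with `s ≥ 1`. -/
def EndsInY (w : Word) : Prop := w.tail ≠ [] ∧ w.lastExp = 0

/-- The number of letters of a reduced word. -/
def length (w : Word) : ℕ := w.exp.natAbs + (w.tail.map fun k => k.natAbs + 1).sum

end Word

/-- The three letters. -/
inductive Letter
  | d | j | y

/-- The first letter of a reduced word and the remaining (reduced) word; `none` for `1`. -/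
def Word.uncons (w : Word) : Option (Letter × Word) :=
  if w.exp < 0 then some (.d, ⟨w.exp + 1, w.tail⟩)
  else if 0 < w.exp then some (.j, ⟨w.exp - 1, w.tail⟩)
  else match w.tail with
    | [] => none
    | a :: l => some (.y, ⟨a, l⟩)

namespace Word

theorem uncons_one : (1 : Word).uncons = none := by simp [uncons, one_def]

theorem uncons_d_mul {w : Word} (h : w.exp ≤ 0) : (d * w).uncons = some (.d, w) := by
  have : -1 + w.exp < 0 := by omega
  simp [uncons, d_mul, this]

theorem uncons_j_mul {w : Word} (h : 0 ≤ w.exp) : (j * w).uncons = some (.j, w) := by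
  have h1 : ¬ (1 + w.exp < 0) := by omega
  have h2 : 0 < 1 + w.exp := by omega
  simp [uncons, j_mul, h1, h2]

theorem uncons_y_mul (w : Word) : (y * w).uncons = some (.y, w) := by
  simp [uncons, y_mul]

theorem eq_one_of_uncons {w : Word} (h : w.uncons = none) : w = 1 := by
  rcases w with ⟨k, _ | ⟨a, l⟩⟩
  · simp only [uncons] at h
    split_ifs at h
    have : k = 0 := by omega
    subst this; rfl
  · simp only [uncons] at h
    split_ifs at h

theorem eq_d_mul_of_uncons {w w' : Word} (h : w.uncons = some (.d, w')) :
    w = d * w' ∧ w'.exp ≤ 0 := by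
  rcases w with ⟨k, _ | ⟨a, l⟩⟩ <;> simp only [uncons] at h <;> split_ifs at h <;>
    simp at h <;> subst h <;> simp [d_mul] <;> omega

theorem eq_j_mul_of_uncons {w w' : Word} (h : w.uncons = some (.j, w')) :
    w = j * w' ∧ 0 ≤ w'.exp := by
  rcases w with ⟨k, _ | ⟨a, l⟩⟩ <;> simp only [uncons] at h <;> split_ifs at h <;>
    simp at h <;> subst h <;> simp [j_mul] <;> omega

theorem eq_y_mul_of_uncons {w w' : Word} (h : w.uncons = some (.y, w')) : w = y * w' := by
  rcases w with ⟨k, _ | ⟨a, l⟩⟩ <;> simp only [uncons] at h <;> split_ifs at h <;>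
    simp at h
  subst h; simp [y_mul]; omega

theorem length_y_mul (w : Word) : (y * w).length = w.length + 1 := by
  simp [length, y_mul]; omega
theorem length_d_mul {w : Word} (h : w.exp ≤ 0) : (d * w).length = w.length + 1 := by
  simp [length, d_mul]; omega
theorem length_j_mul {w : Word} (h : 0 ≤ w.exp) : (j * w).length = w.length + 1 := by
  simp [length, j_mul]; omega

theorem length_of_uncons {w w' : Word} {a : Letter} (h : w.uncons = some (a, w')) :
    w.length = w'.length + 1 := by
  cases a
  · obtain ⟨rfl, h'⟩ := eq_d_mul_of_uncons h; exact length_d_mul h'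
  · obtain ⟨rfl, h'⟩ := eq_j_mul_of_uncons h; exact length_j_mul h'
  · rw [eq_y_mul_of_uncons h]; exact length_y_mul w'

end Word

/-! ### The algebra `ℚ⟨d, j, y⟩` and the product `ш₀` -/

/-- The non-commutative polynomial ring `ℚ⟨d, j, y⟩` with `dj = jd = 1`. -/
abbrev A : Type := MonoidAlgebra ℚ Word

/-- A word, as an element of `ℚ⟨d, j, y⟩`. -/
abbrev A.ofWord (w : Word) : A := MonoidAlgebra.single w 1

abbrev A.d : A := A.ofWord Word.d
abbrev A.j : A := A.ofWord Word.j
abbrev A.y : A := A.ofWord Word.y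

/-- The integral power `j^k`, where `j^{-k} = d^k`. -/
abbrev A.jpow (k : ℤ) : A := A.ofWord ⟨k, []⟩

/-- The product `ш₀` of two reduced words, by recursion. The words `u` and `v` are split as first
letter times remaining reduced word; see `shuffleWord_one_left`, …, `shuffleWord_j_d` below for the
defining equations. -/
def shuffleWord (u v : Word) : A :=
  match _hu : u.uncons, _hv : v.uncons with
  | none, _ => A.ofWord v
  | some _, none => A.ofWord u
  | some (.y, u'), some _ => A.y * shuffleWord u' v
  | some (.d, _), some (.y, v') => A.y * shuffleWord u v'
  | some (.j, _), some (.y, v') => A.y * shuffleWord u v'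
  | some (.j, u'), some (.j, v') => A.j * shuffleWord u' v + A.j * shuffleWord u v'
  | some (.d, u'), some (.d, _) => A.d * shuffleWord u' v - shuffleWord u' (Word.d * v)
  | some (.d, u'), some (.j, v') => A.d * shuffleWord u' v - shuffleWord u' v'
  | some (.j, u'), some (.d, v') => A.d * shuffleWord u v' - shuffleWord u' v'
termination_by (u.length + v.length, u.length)
decreasing_by
  all_goals
    try have h1 := Word.length_of_uncons _hu
    try have h2 := Word.length_of_uncons _hv
    first
    | (apply Prod.Lex.left; omega)
    | (have h3 := Word.eq_d_mul_of_uncons _hv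
       have h4 : (Word.d * v).length = v.length + 1 := Word.length_d_mul (by
         rw [h3.1, Word.d_mul]; have := h3.2; simp; omega)
       rw [Prod.lex_def]; right; simp; omega)

theorem ofWord_mul (u v : Word) : A.ofWord (u * v) = A.ofWord u * A.ofWord v := by
  simp [MonoidAlgebra.single_mul_single]

theorem shuffleWord_one_left (v : Word) : shuffleWord 1 v = A.ofWord v := by
  have h := Word.uncons_one
  rw [shuffleWord]; split <;> simp_all

theorem shuffleWord_one_right (u : Word) : shuffleWord u 1 = A.ofWord u := by
  have h := Word.uncons_one
  rcases h' : u.uncons with _ | ⟨_ | _ | _, w⟩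
  · rw [Word.eq_one_of_uncons h', shuffleWord_one_left]
  all_goals rw [shuffleWord]; split <;> simp_all

theorem shuffleWord_y_left (u v : Word) :
    shuffleWord (Word.y * u) v = A.y * shuffleWord u v := by
  have h := Word.uncons_y_mul u
  rcases h' : v.uncons with _ | ⟨_ | _ | _, w⟩
  · rw [Word.eq_one_of_uncons h', shuffleWord_one_right, shuffleWord_one_right, ofWord_mul]
  all_goals rw [shuffleWord]; split <;> simp_all

theorem shuffleWord_y_right (u v : Word) :
    shuffleWord u (Word.y * v) = A.y * shuffleWord u v := by
  have h' := Word.uncons_y_mul v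
  induction hn : u.length generalizing u with
  | zero =>
    have : u.uncons = none := by
      rcases h : u.uncons with _ | ⟨a, w⟩
      · rfl
      · have := Word.length_of_uncons h; omega
    rw [Word.eq_one_of_uncons this, shuffleWord_one_left, shuffleWord_one_left, ofWord_mul]
  | succ n ih =>
    rcases h : u.uncons with _ | ⟨_ | _ | _, w⟩
    · rw [Word.eq_one_of_uncons h, shuffleWord_one_left, shuffleWord_one_left, ofWord_mul]
    · clear ih
      rw [shuffleWord]; split <;> simp_all
    · clear ih
      rw [shuffleWord]; split <;> simp_all
    · have := Word.length_of_uncons h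
      rw [Word.eq_y_mul_of_uncons h, shuffleWord_y_left, shuffleWord_y_left,
        ih _ (by omega)]

theorem shuffleWord_j_j {u v : Word} (hu : 0 ≤ u.exp) (hv : 0 ≤ v.exp) :
    shuffleWord (Word.j * u) (Word.j * v) =
      A.j * shuffleWord u (Word.j * v) + A.j * shuffleWord (Word.j * u) v := by
  have h := Word.uncons_j_mul hu
  have h' := Word.uncons_j_mul hv
  rw [shuffleWord]; split <;> simp_all

theorem shuffleWord_d_d {u v : Word} (hu : u.exp ≤ 0) (hv : v.exp ≤ 0) :
    shuffleWord (Word.d * u) (Word.d * v) =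
      A.d * shuffleWord u (Word.d * v) - shuffleWord u (Word.d * (Word.d * v)) := by
  have h := Word.uncons_d_mul hu
  have h' := Word.uncons_d_mul hv
  rw [shuffleWord]; split <;> simp_all

theorem shuffleWord_d_j {u v : Word} (hu : u.exp ≤ 0) (hv : 0 ≤ v.exp) :
    shuffleWord (Word.d * u) (Word.j * v) =
      A.d * shuffleWord u (Word.j * v) - shuffleWord u v := by
  have h := Word.uncons_d_mul hu
  have h' := Word.uncons_j_mul hv
  rw [shuffleWord]; split <;> simp_all

theorem shuffleWord_j_d {u v : Word} (hu : 0 ≤ u.exp) (hv : v.exp ≤ 0) :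
    shuffleWord (Word.j * u) (Word.d * v) =
      A.d * shuffleWord (Word.j * u) v - shuffleWord u v := by
  have h := Word.uncons_j_mul hu
  have h' := Word.uncons_d_mul hv
  rw [shuffleWord]; split <;> simp_all

/-- The product `ш₀` on `ℚ⟨d, j, y⟩`, extended bilinearly from words. -/
def shuffle : A →ₗ[ℚ] A →ₗ[ℚ] A :=
  (MonoidAlgebra.basis Word ℚ).constr ℚ fun u =>
    (MonoidAlgebra.basis Word ℚ).constr ℚ fun v => shuffleWord u v

theorem shuffle_ofWord (u v : Word) : shuffle (A.ofWord u) (A.ofWord v) = shuffleWord u v := by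
  have h (w : Word) : A.ofWord w = MonoidAlgebra.basis Word ℚ w := by simp
  rw [h u, h v, shuffle, Module.Basis.constr_basis, Module.Basis.constr_basis]

/-! ### The subspaces `𝒯`, `ℒ` -/

/-- `𝒯`: the span of the words `j^{k₁} y ⋯ y j^{kᵣ}` with `kᵣ ≠ 0`. -/
def T : Submodule ℚ A := Submodule.span ℚ (A.ofWord '' {w | w.lastExp ≠ 0})

/-- Two-sided ideals of the non-associative algebra `(ℚ⟨d, j, y⟩, ш₀)`. -/
def IsShuffleIdeal (I : Submodule ℚ A) : Prop :=
  ∀ a : A, ∀ x ∈ I, shuffle a x ∈ I ∧ shuffle x a ∈ I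

/-- The two-sided ideal of `(ℚ⟨d, j, y⟩, ш₀)` generated by a set. -/
def shuffleIdealSpan (S : Set A) : Submodule ℚ A := sInf {I | IsShuffleIdeal I ∧ S ⊆ I}

/-- The elements `j^k (d(u ш₀ v) - du ш₀ v - u ш₀ dv)`, for `k ∈ ℤ` and words `u, v` ending
in `y`. -/
def leibnizElements : Set A :=
  {x | ∃ (k : ℤ) (u v : Word), u.EndsInY ∧ v.EndsInY ∧
    x = A.jpow k * (A.d * shuffle (A.ofWord u) (A.ofWord v)
      - shuffle (A.d * A.ofWord u) (A.ofWord v) - shuffle (A.ofWord u) (A.d * A.ofWord v))}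

/-- `ℒ`: the two-sided ideal generated by the `leibnizElements`. -/
def L : Submodule ℚ A := shuffleIdealSpan leibnizElements

theorem isShuffleIdeal_L : IsShuffleIdeal L := fun a x hx =>
  ⟨Submodule.mem_sInf.2 fun I hI => (hI.1 a x (Submodule.mem_sInf.1 hx I hI)).1,
   Submodule.mem_sInf.2 fun I hI => (hI.1 a x (Submodule.mem_sInf.1 hx I hI)).2⟩

/-! ### The subalgebra `ℚ⟨d, y⟩` -/

/-- The subalgebra `ℚ⟨d, y⟩` of `ℚ⟨d, j, y⟩` generated by `d` and `y`. -/
def Qdy : Subalgebra ℚ A := Algebra.adjoin ℚ {A.d, A.y}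

/-- The words in `d, y`. -/
def Word.IsDY (w : Word) : Prop := w.exp ≤ 0 ∧ ∀ k ∈ w.tail, k ≤ 0

theorem Word.IsDY.mul {u v : Word} (hu : u.IsDY) (hv : v.IsDY) : (u * v).IsDY := by
  rcases u with ⟨k, l⟩
  induction l generalizing k with
  | nil =>
    rw [Word.mul_nil]
    have h1 := hu.1
    have h2 := hv.1
    exact ⟨by simp at h1 ⊢; omega, hv.2⟩
  | cons a l ih =>
    rw [Word.mul_cons]
    have := ih a ⟨hu.2 a (by simp), fun k hk => hu.2 k (List.mem_cons_of_mem _ hk)⟩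
    refine ⟨hu.1, fun b hb => ?_⟩
    rcases List.mem_cons.1 hb with rfl | hb
    · exact this.1
    · exact this.2 b hb

theorem Word.isDY_d : Word.d.IsDY := by simp [Word.IsDY, Word.d]
theorem Word.isDY_y : Word.y.IsDY := by simp [Word.IsDY, Word.y]

/-- Induction for words in `d, y`. -/
theorem Word.IsDY.induction {P : Word → Prop} (one : P 1)
    (d : ∀ w, w.IsDY → P w → P (Word.d * w)) (y : ∀ w, w.IsDY → P w → P (Word.y * w))
    {w : Word} (hw : w.IsDY) : P w := by
  induction hn : w.length generalizing w with
  | zero =>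
    have : w.uncons = none := by
      rcases h : w.uncons with _ | ⟨a, w⟩
      · rfl
      · have := Word.length_of_uncons h; omega
    rwa [Word.eq_one_of_uncons this]
  | succ n ih =>
    rcases h : w.uncons with _ | ⟨_ | _ | _, w'⟩
    · rwa [Word.eq_one_of_uncons h]
    · have hl := Word.length_of_uncons h
      obtain ⟨rfl, h'⟩ := Word.eq_d_mul_of_uncons h
      have : w'.IsDY := ⟨h', hw.2⟩
      exact d _ this (ih this (by omega))
    · obtain ⟨rfl, h'⟩ := Word.eq_j_mul_of_uncons h
      have := hw.1
      simp [Word.j_mul] at this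
      omega
    · have hl := Word.length_of_uncons h
      obtain rfl := Word.eq_y_mul_of_uncons h
      have : w'.IsDY := by
        rw [Word.y_mul] at hw
        exact ⟨hw.2 _ (by simp), fun k hk => hw.2 k (List.mem_cons_of_mem _ hk)⟩
      exact y _ this (ih this (by omega))

theorem ofWord_mem_Qdy {w : Word} (hw : w.IsDY) : A.ofWord w ∈ Qdy := by
  refine hw.induction (P := fun w => A.ofWord w ∈ Qdy) Qdy.one_mem ?_ ?_
  · intro w _ h
    rw [ofWord_mul]
    exact Qdy.mul_mem (Algebra.subset_adjoin (by simp)) h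
  · intro w _ h
    rw [ofWord_mul]
    exact Qdy.mul_mem (Algebra.subset_adjoin (by simp)) h

theorem mem_Qdy_iff {x : A} :
    x ∈ Qdy ↔ x ∈ Submodule.span ℚ (A.ofWord '' {w | w.IsDY}) := by
  constructor
  · intro hx
    have hmul (a b : A) (ha : a ∈ Submodule.span ℚ (A.ofWord '' {w | w.IsDY}))
        (hb : b ∈ Submodule.span ℚ (A.ofWord '' {w | w.IsDY})) :
        a * b ∈ Submodule.span ℚ (A.ofWord '' {w | w.IsDY}) := by
      have := Submodule.mul_mem_mul ha hb
      rw [Submodule.span_mul_span] at this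
      refine Submodule.span_mono ?_ this
      rintro _ ⟨_, ⟨u, hu, rfl⟩, _, ⟨v, hv, rfl⟩, rfl⟩
      exact ⟨u * v, hu.mul hv, ofWord_mul u v⟩
    have hone : (1 : A) ∈ Submodule.span ℚ (A.ofWord '' {w | w.IsDY}) :=
      Submodule.subset_span ⟨1, by simp [Word.IsDY, Word.one_def], rfl⟩
    induction hx using Algebra.adjoin_induction with
    | mem x hx =>
      rcases hx with rfl | rfl
      · exact Submodule.subset_span ⟨_, Word.isDY_d, rfl⟩
      · exact Submodule.subset_span ⟨_, Word.isDY_y, rfl⟩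
    | algebraMap r =>
      rw [Algebra.algebraMap_eq_smul_one]
      exact Submodule.smul_mem _ _ hone
    | add a b _ _ ha hb => exact Submodule.add_mem _ ha hb
    | mul a b _ _ ha hb => exact hmul a b ha hb
  · intro hx
    refine (Submodule.span_le (p := Subalgebra.toSubmodule Qdy)).2 ?_ hx
    rintro _ ⟨w, hw, rfl⟩
    exact ofWord_mem_Qdy hw

theorem mem_Qdy_inf_T_iff {x : A} :
    x ∈ Qdy ∧ x ∈ T ↔
      x ∈ Submodule.span ℚ (A.ofWord '' {w | w.IsDY ∧ w.lastExp ≠ 0}) := by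
  rw [mem_Qdy_iff, T, ← MonoidAlgebra.supported_eq_span_single,
    ← MonoidAlgebra.supported_eq_span_single, ← MonoidAlgebra.supported_eq_span_single,
    MonoidAlgebra.mem_supported, MonoidAlgebra.mem_supported, MonoidAlgebra.mem_supported,
    ← Set.subset_inter_iff]
  rfl

theorem Word.lastExp_y_mul (w : Word) : (Word.y * w).lastExp = w.lastExp := by
  rw [Word.y_mul]; simp [Word.lastExp]

theorem Word.lastExp_d_mul {w : Word} (hw : w.IsDY) (h : w.lastExp ≠ 0) :
    (Word.d * w).lastExp ≠ 0 := by
  rcases w with ⟨k, _ | ⟨a, l⟩⟩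
  · have := hw.1
    simp [Word.lastExp, Word.d_mul] at this ⊢
    omega
  · simpa [Word.lastExp, Word.d_mul] using h

theorem Word.lastExp_of_d_mul {w : Word} (h : (Word.d * w).lastExp ≠ 0) :
    w = 1 ∨ w.lastExp ≠ 0 := by
  rcases w with ⟨k, _ | ⟨a, l⟩⟩
  · by_cases hk : k = 0
    · left; rw [hk]; rfl
    · right; simpa [Word.lastExp] using hk
  · right; simpa [Word.lastExp, Word.d_mul] using h

theorem mul_mem_Qdy_inf_T {a x : A} (ha : a = A.d ∨ a = A.y) (hx : x ∈ Qdy ∧ x ∈ T) :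
    a * x ∈ Qdy ∧ a * x ∈ T := by
  rw [mem_Qdy_inf_T_iff] at hx ⊢
  induction hx using Submodule.span_induction with
  | mem x hx =>
    obtain ⟨w, hw, rfl⟩ := hx
    rcases ha with rfl | rfl
    · exact Submodule.subset_span
        ⟨Word.d * w, ⟨Word.isDY_d.mul hw.1, Word.lastExp_d_mul hw.1 hw.2⟩, ofWord_mul _ _⟩
    · refine Submodule.subset_span
        ⟨Word.y * w, ⟨Word.isDY_y.mul hw.1, ?_⟩, ofWord_mul _ _⟩
      rw [Word.lastExp_y_mul]; exact hw.2
  | zero => simp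
  | add x y _ _ hx hy => rw [mul_add]; exact Submodule.add_mem _ hx hy
  | smul r x _ hx => rw [mul_smul_comm]; exact Submodule.smul_mem _ _ hx

theorem shuffleWord_mem_Qdy {u v : Word} (hu : u.IsDY) (hv : v.IsDY) :
    shuffleWord u v ∈ Qdy := by
  have hd : A.d ∈ Qdy := Algebra.subset_adjoin (by simp)
  have hy : A.y ∈ Qdy := Algebra.subset_adjoin (by simp)
  refine hu.induction
    (P := fun u => ∀ v : Word, v.IsDY → shuffleWord u v ∈ Qdy) ?_ ?_ ?_ v hv
  · intro v hv
    rw [shuffleWord_one_left]; exact ofWord_mem_Qdy hv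
  · intro u hu ih v hv
    refine hv.induction (P := fun v => shuffleWord (Word.d * u) v ∈ Qdy) ?_ ?_ ?_
    · rw [shuffleWord_one_right]; exact ofWord_mem_Qdy (Word.isDY_d.mul hu)
    · intro v hv _
      rw [shuffleWord_d_d hu.1 hv.1]
      exact Qdy.sub_mem (Qdy.mul_mem hd (ih _ (Word.isDY_d.mul hv)))
        (ih _ (Word.isDY_d.mul (Word.isDY_d.mul hv)))
    · intro v _ ih'
      rw [shuffleWord_y_right]
      exact Qdy.mul_mem hy ih'
  · intro u _ ih v hv
    rw [shuffleWord_y_left]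
    exact Qdy.mul_mem hy (ih v hv)

theorem shuffleWord_mem_T {u v : Word} (hu : u.IsDY) (hv : v.IsDY)
    (h : u.lastExp ≠ 0 ∨ v.lastExp ≠ 0) :
    shuffleWord u v ∈ Qdy ∧ shuffleWord u v ∈ T := by
  have hw {w : Word} (hw : w.IsDY) (h : w.lastExp ≠ 0) : A.ofWord w ∈ Qdy ∧ A.ofWord w ∈ T :=
    ⟨ofWord_mem_Qdy hw, Submodule.subset_span ⟨w, h, rfl⟩⟩
  have one : (1 : Word).lastExp = 0 := rfl
  refine hu.induction
    (P := fun u => ∀ v : Word, v.IsDY → (u.lastExp ≠ 0 ∨ v.lastExp ≠ 0) →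
      shuffleWord u v ∈ Qdy ∧ shuffleWord u v ∈ T) ?_ ?_ ?_ v hv h
  · intro v hv h
    rw [shuffleWord_one_left]
    exact hw hv (h.resolve_left (by simp [one]))
  · intro u hu ih v hv
    refine hv.induction (P := fun v => ((Word.d * u).lastExp ≠ 0 ∨ v.lastExp ≠ 0) →
      shuffleWord (Word.d * u) v ∈ Qdy ∧ shuffleWord (Word.d * u) v ∈ T) ?_ ?_ ?_
    · intro h
      rw [shuffleWord_one_right]
      exact hw (Word.isDY_d.mul hu) (h.resolve_right (by simp [one]))
    · intro v hv _ h
      by_cases hu1 : u = 1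
      · rw [shuffleWord_d_d hu.1 hv.1, hu1, shuffleWord_one_left, shuffleWord_one_left,
          ← ofWord_mul, sub_self]
        exact ⟨Qdy.zero_mem, T.zero_mem⟩
      · have hv' := Word.isDY_d.mul hv
        have h1 : u.lastExp ≠ 0 ∨ (Word.d * v).lastExp ≠ 0 :=
          h.imp_left fun h => (Word.lastExp_of_d_mul h).resolve_left hu1
        have h2 := mul_mem_Qdy_inf_T (Or.inl rfl) (ih _ hv' h1)
        have h3 := ih _ (Word.isDY_d.mul hv') (h1.imp_right (Word.lastExp_d_mul hv'))
        rw [shuffleWord_d_d hu.1 hv.1]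
        exact ⟨Qdy.sub_mem h2.1 h3.1, T.sub_mem h2.2 h3.2⟩
    · intro v _ ih' h
      rw [Word.lastExp_y_mul] at h
      rw [shuffleWord_y_right]
      exact mul_mem_Qdy_inf_T (Or.inr rfl) (ih' h)
  · intro u _ ih v hv h
    rw [Word.lastExp_y_mul] at h
    rw [shuffleWord_y_left]
    exact mul_mem_Qdy_inf_T (Or.inr rfl) (ih v hv h)

/-- `ℚ⟨d, y⟩` is a subalgebra of `(ℚ⟨d, j, y⟩, ш₀)`. -/
theorem shuffle_mem_Qdy {a b : A} (ha : a ∈ Qdy) (hb : b ∈ Qdy) : shuffle a b ∈ Qdy := by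
  have h := Submodule.apply_mem_map₂ shuffle (mem_Qdy_iff.1 ha) (mem_Qdy_iff.1 hb)
  rw [Submodule.map₂_span_span] at h
  refine (Submodule.span_le (p := Subalgebra.toSubmodule Qdy)).2 ?_ h
  rintro _ ⟨_, ⟨u, hu, rfl⟩, _, ⟨v, hv, rfl⟩, rfl⟩
  change shuffle (A.ofWord u) (A.ofWord v) ∈ Qdy
  rw [shuffle_ofWord]
  exact shuffleWord_mem_Qdy hu hv

theorem shuffle_mem_T {a b : A} (ha : a ∈ Qdy) (hb : b ∈ Qdy) (h : a ∈ T ∨ b ∈ T) :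
    shuffle a b ∈ T := by
  rcases h with h | h
  · have h := Submodule.apply_mem_map₂ shuffle (mem_Qdy_inf_T_iff.1 ⟨ha, h⟩) (mem_Qdy_iff.1 hb)
    rw [Submodule.map₂_span_span] at h
    refine Submodule.span_le.2 ?_ h
    rintro _ ⟨_, ⟨u, hu, rfl⟩, _, ⟨v, hv, rfl⟩, rfl⟩
    change shuffle (A.ofWord u) (A.ofWord v) ∈ T
    rw [shuffle_ofWord]
    exact (shuffleWord_mem_T hu.1 hv (Or.inl hu.2)).2
  · have h := Submodule.apply_mem_map₂ shuffle (mem_Qdy_iff.1 ha) (mem_Qdy_inf_T_iff.1 ⟨hb, h⟩)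
    rw [Submodule.map₂_span_span] at h
    refine Submodule.span_le.2 ?_ h
    rintro _ ⟨_, ⟨u, hu, rfl⟩, _, ⟨v, hv, rfl⟩, rfl⟩
    change shuffle (A.ofWord u) (A.ofWord v) ∈ T
    rw [shuffle_ofWord]
    exact (shuffleWord_mem_T hu hv.1 (Or.inr hv.2)).2

/-- The product `ш₀` on `ℚ⟨d, y⟩`. -/
def Qdy.shuffle : Qdy →ₗ[ℚ] Qdy →ₗ[ℚ] Qdy :=
  LinearMap.mk₂ ℚ (fun a b => ⟨ShuffleZero.shuffle a b, shuffle_mem_Qdy a.2 b.2⟩)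
    (fun _ _ _ => Subtype.ext (by simp)) (fun _ _ _ => Subtype.ext (by simp))
    (fun _ _ _ => Subtype.ext (by simp)) (fun _ _ _ => Subtype.ext (by simp))

/-! ### The algebra `ℋ₋` -/

/-- `𝒯₋ = ℚ⟨d, y⟩ ∩ 𝒯`, as a subspace of `ℚ⟨d, y⟩`. -/
def TMinus : Submodule ℚ Qdy := T.comap Qdy.val.toLinearMap

/-- `ℒ₋ = ℚ⟨d, y⟩ ∩ ℒ`, as a subspace of `ℚ⟨d, y⟩`. -/
def LMinus : Submodule ℚ Qdy := L.comap Qdy.val.toLinearMap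

/-- `ℋ₋ = ℚ⟨d, y⟩ / (𝒯₋ + ℒ₋)`. -/
abbrev HMinus : Type := Qdy ⧸ (TMinus ⊔ LMinus)

theorem Qdy.shuffle_mem_ideal (a b : Qdy) (h : a ∈ TMinus ⊔ LMinus ∨ b ∈ TMinus ⊔ LMinus) :
    Qdy.shuffle a b ∈ TMinus ⊔ LMinus := by
  rcases h with h | h <;> obtain ⟨s, hs, t, ht, rfl⟩ := Submodule.mem_sup.1 h
  · rw [map_add, LinearMap.add_apply]
    exact Submodule.add_mem_sup (shuffle_mem_T s.2 b.2 (Or.inl hs))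
      (isShuffleIdeal_L b t ht).2
  · rw [map_add]
    exact Submodule.add_mem_sup (shuffle_mem_T a.2 s.2 (Or.inr hs))
      (isShuffleIdeal_L a t ht).1

/-- The class in `ℋ₋` of an element of `ℚ⟨d, y⟩`. -/
def HMinus.mk : Qdy →ₗ[ℚ] HMinus := (TMinus ⊔ LMinus).mkQ

/-- The product `ш₀` on `ℋ₋` induced by the one on `ℚ⟨d, y⟩`. -/
def HMinus.shuffle : HMinus →ₗ[ℚ] HMinus →ₗ[ℚ] HMinus :=
  LinearMap.liftQ₂ _ _ (Qdy.shuffle.compr₂ HMinus.mk)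
    (fun a ha => LinearMap.mem_ker.2 <| LinearMap.ext fun b =>
      (Submodule.Quotient.mk_eq_zero _).2 (Qdy.shuffle_mem_ideal a b (Or.inl ha)))
    (fun b hb => LinearMap.mem_ker.2 <| LinearMap.ext fun a =>
      (Submodule.Quotient.mk_eq_zero _).2 (Qdy.shuffle_mem_ideal a b (Or.inr hb)))

theorem HMinus.shuffle_mk (a b : Qdy) :
    HMinus.shuffle (HMinus.mk a) (HMinus.mk b) = HMinus.mk (Qdy.shuffle a b) := rfl

/-- The generators of `ℚ⟨d, y⟩`. -/
def Qdy.d : Qdy := ⟨A.d, Algebra.subset_adjoin (by simp)⟩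
/-- The generators of `ℚ⟨d, y⟩`. -/
def Qdy.y : Qdy := ⟨A.y, Algebra.subset_adjoin (by simp)⟩

/-- The element `d^{k₁} y d^{k₂} y ⋯ d^{kₛ} y` of `ℚ⟨d, y⟩` for a list `k₁, …, kₛ`. -/
def Qdy.word (k : List ℕ) : Qdy := (k.map fun a => Qdy.d ^ a * Qdy.y).prod

end ShuffleZero

end

namespace ShuffleZero

/-! Since `y` passes out of `ш₀` on the left, `y ш₀ w = y(1 ш₀ w) = yw`. With `w = d^{k₂}y⋯d^{kᵣ}y`,
the left-hand side is therefore `d^{k₁}(y ш₀ w)`, and the claim is the binomial Leibniz rule for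
`d^{k₁}` applied to this product.

On words ending in `y`, the generators of `ℒ` make `d` a derivation of `ш₀` modulo `ℒ`. Iterating
requires the Leibniz defect to stay in `ℒ` after concatenation with `d^n` on the left. As `ℒ` is an
ideal for `ш₀` and not by definition for concatenation, this comes from the prefix `j^k` in the
generators (`d_pow_mul_leibniz_mem_L`). The iterated rule is `d_pow_mul_shuffle_sub_sum_mem_L`;
`HMinus.mk_word_cons` carries it to the quotient. The two sides already agree modulo `ℒ₋`, without
`𝒯₋`. -/

/-! ### Words ending in `y` -/

/-- A left factor `d` changes only the first exponent, and as soon as a `y` occurs this is not the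
last one. This stability lets the Leibniz rule be iterated. -/
theorem Word.EndsInY.d_mul {w : Word} (hw : w.EndsInY) : (Word.d * w).EndsInY := by
  rcases w with ⟨k, _ | ⟨a, l⟩⟩
  · exact absurd rfl hw.1
  · exact ⟨by simp [Word.d_mul], by simpa [Word.lastExp, Word.d_mul] using hw.2⟩

theorem Word.EndsInY.d_pow_mul {w : Word} (hw : w.EndsInY) (n : ℕ) :
    (Word.d ^ n * w).EndsInY := by
  induction n with
  | zero => simpa using hw
  | succ n ih => rw [pow_succ', mul_assoc]; exact ih.d_mul

theorem Word.endsInY_y : Word.y.EndsInY := ⟨by simp [Word.y], rfl⟩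

theorem Word.EndsInY.y_mul {w : Word} (hw : w.EndsInY) : (Word.y * w).EndsInY :=
  ⟨by simp [Word.y_mul], by rw [Word.lastExp_y_mul]; exact hw.2⟩

/-- Puts powers of `d` into the form `j^k` in which they occur in `leibnizElements`. -/
theorem Word.d_pow (n : ℕ) : Word.d ^ n = ⟨-(n : ℤ), []⟩ := by
  induction n with
  | zero => rfl
  | succ n ih => rw [pow_succ', ih, Word.d_mul]; simp

theorem ofWord_d_pow (n : ℕ) : A.ofWord (Word.d ^ n) = A.d ^ n := by
  simp [MonoidAlgebra.single_pow]

/-! ### The Leibniz rule modulo `ℒ` -/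

/-- `d` acts as a derivation of `ш₀` modulo `ℒ`, also after multiplication by a power of `d`. -/
theorem d_pow_mul_leibniz_mem_L {u v : Word} (hu : u.EndsInY) (hv : v.EndsInY) (n : ℕ) :
    A.d ^ n * (A.d * shuffle (A.ofWord u) (A.ofWord v)
      - shuffle (A.d * A.ofWord u) (A.ofWord v)
      - shuffle (A.ofWord u) (A.d * A.ofWord v)) ∈ L := by
  -- The element is itself a generator, with `k = -n` because `d^n = j^{-n}`.
  refine Submodule.mem_sInf.2 fun I hI => hI.2 ⟨-(n : ℤ), u, v, hu, hv, ?_⟩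
  rw [← ofWord_d_pow, Word.d_pow]

/-- The iterated Leibniz rule modulo `ℒ`. -/
theorem d_pow_mul_shuffle_sub_sum_mem_L (n : ℕ) {u v : Word} (hu : u.EndsInY)
    (hv : v.EndsInY) :
    A.d ^ n * shuffle (A.ofWord u) (A.ofWord v) -
      ∑ p ∈ Finset.HasAntidiagonal.antidiagonal n, n.choose p.1 •
        shuffle (A.d ^ p.1 * A.ofWord u) (A.d ^ p.2 * A.ofWord v) ∈ L := by
  induction n generalizing u v with
  | zero => simp
  | succ n ih =>
    -- Modulo `ℒ`, `d^{n+1}(u ш₀ v)` is `d^n(du ш₀ v) + d^n(u ш₀ dv)`, so the induction hypothesis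
    -- is needed at `(du, v)` and `(u, dv)`.
    have h₀ := d_pow_mul_leibniz_mem_L hu hv n
    have h₁ := ih hu.d_mul hv
    have h₂ := ih hu hv.d_mul
    have h := L.add_mem (L.add_mem h₀ h₁) h₂
    -- Pascal's rule splits the sum for `n + 1` into the two sums for `n`. One of them carries
    -- `n.choose p.2`, which `hs` turns into the `n.choose p.1` of the induction hypothesis, using
    -- `p.1 + p.2 = n`.
    rw [Finset.sum_antidiagonal_choose_succ_nsmul (fun i j =>
      shuffle (A.d ^ i * A.ofWord u) (A.d ^ j * A.ofWord v))]
    have hs : ∑ p ∈ Finset.HasAntidiagonal.antidiagonal n, n.choose p.2 •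
          shuffle (A.d ^ (p.1 + 1) * A.ofWord u) (A.d ^ p.2 * A.ofWord v) =
        ∑ p ∈ Finset.HasAntidiagonal.antidiagonal n, n.choose p.1 •
          shuffle (A.d ^ (p.1 + 1) * A.ofWord u) (A.d ^ p.2 * A.ofWord v) :=
      Finset.sum_congr rfl fun p hp => by
        rw [Nat.choose_symm_of_eq_add (Finset.HasAntidiagonal.mem_antidiagonal.1 hp).symm]
    rw [hs]
    convert h using 1
    simp only [ofWord_mul, pow_succ, mul_assoc, mul_sub]
    abel

/-! ### Passage to `ℋ₋` -/

/-- The Leibniz rule is stated for single reduced words, so the product in `ℚ⟨d, y⟩` must be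
recognised as one. The empty list gives `1`, which does not end in `y`. -/
theorem Qdy.coe_word_mem (l : List ℕ) (hl : l ≠ []) :
    ∃ w : Word, w.EndsInY ∧ (Qdy.word l : A) = A.ofWord w := by
  induction l with
  | nil => exact absurd rfl hl
  | cons a l ih =>
    by_cases h : l = []
    · refine ⟨Word.d ^ a * Word.y, Word.endsInY_y.d_pow_mul a, ?_⟩
      rw [ofWord_mul, ofWord_d_pow]
      simp [h, Qdy.word, Qdy.d, Qdy.y]
    · obtain ⟨w, hw, h'⟩ := ih h
      refine ⟨Word.d ^ a * (Word.y * w), hw.y_mul.d_pow_mul a, ?_⟩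
      rw [ofWord_mul, ofWord_mul, ofWord_d_pow, ← h']
      simp [Qdy.word, Qdy.d, Qdy.y, mul_assoc]

theorem HMinus.mk_word_cons (n : ℕ) (l : List ℕ) (hl : l ≠ []) :
    HMinus.mk (Qdy.word (n :: l)) =
      ∑ p ∈ Finset.HasAntidiagonal.antidiagonal n, (n.choose p.1 : ℚ) •
        HMinus.shuffle (HMinus.mk (Qdy.d ^ p.1 * Qdy.y))
          (HMinus.mk (Qdy.d ^ p.2 * Qdy.word l)) := by
  obtain ⟨w, hw, h⟩ := Qdy.coe_word_mem l hl
  simp only [HMinus.shuffle_mk, ← map_smul, ← map_sum]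
  -- The difference of the two sides is shown to lie in `ℒ₋` alone.
  refine (Submodule.Quotient.eq _).2 (Submodule.mem_sup_right ?_)
  have key := d_pow_mul_shuffle_sub_sum_mem_L n Word.endsInY_y hw
  -- This turns the left-hand term `d^n(y ш₀ w)` of the Leibniz rule into the word `d^n y w`.
  have hyw : ShuffleZero.shuffle (A.ofWord Word.y) (A.ofWord w) = A.y * A.ofWord w := by
    rw [shuffle_ofWord, ← mul_one Word.y, shuffleWord_y_left, shuffleWord_one_left]
  rw [hyw, ← h] at key
  rw [LMinus, Submodule.mem_comap, map_sub, map_sum]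
  convert key using 2
  · simp [Qdy.word, Qdy.d, Qdy.y, mul_assoc]
  · refine Finset.sum_congr rfl fun p _ => ?_
    rw [map_smul, map_smul, Nat.cast_smul_eq_nsmul]
    rfl

end ShuffleZero

open ShuffleZero in
theorem mainTheorem8 (r : ℕ) (hr : 2 ≤ r) (k : Fin r → ℕ) :
    HMinus.mk (Qdy.word (List.ofFn k)) =
      ∑ p ∈ Finset.HasAntidiagonal.antidiagonal (k ⟨0, by omega⟩),
        ((k ⟨0, by omega⟩).choose p.1 : ℚ) •
          HMinus.shuffle (HMinus.mk (Qdy.d ^ p.1 * Qdy.y))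
            (HMinus.mk (Qdy.d ^ p.2 * Qdy.word (List.ofFn k).tail)) := by
  -- With `r = s + 2` the list splits off its head `k₁` and the tail `k₂, …, kᵣ` is visibly
  -- nonempty.
  obtain ⟨r, rfl⟩ : ∃ s, r = s + 2 := ⟨r - 2, by omega⟩
  rw [List.ofFn_succ]
  exact HMinus.mk_word_cons _ _ (by simp)
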